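/- Let $d\ge 0$ be an integer and let $A\subset\mathbb{Z}^d$ be a non-empty set with $|A|\le 5$. Suppose that $A$ is spectral in $\mathbb{Z}^d$, i.e. there is a set $\Lambda$ of characters $\mathbb{Z}^d\to\{z\in\mathbb{C}:|z|=1\}$ whose restrictions to $A$ form an orthogonal basis of $L^2(A)$ (with respect to counting measure). Then $A$ tiles $\mathbb{Z}^d$ by translation, i.e. there is a set $T\subseteq\mathbb{Z}^d$ such that every $x\in\mathbb{Z}^d$ can be written in exactly one way as $x=a+t$ with $a\in A$ and $t\in T$. -/

import Mathlib

namespace SpectralTile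

/-- The restriction to the finite set `A` of a (unitary) character `χ` of the discrete abelian group
`G`, as an element of `L²(A)`. For the counting measure (the Haar measure of `G`) the space
`L²(A)` is `EuclideanSpace ℂ A`, and every character of `G` is continuous. -/
noncomputable def restrict {G : Type*} [AddCommGroup G] (A : Finset G) (χ : AddChar G Circle) :
    EuclideanSpace ℂ A :=
  WithLp.toLp 2 fun a : A => ((χ (a : G) : Circle) : ℂ)

/-- `Λ` is a spectrum of `A`: the restrictions of the characters in `Λ` form an orthogonal basis
of `L²(A)`. -/
structure IsSpectrum {G : Type*} [AddCommGroup G] (A : Finset G) (Λ : Set (AddChar G Circle)) :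
    Prop where
  orthogonal : ∀ χ ∈ Λ, ∀ ψ ∈ Λ, χ ≠ ψ → inner ℂ (restrict A χ) (restrict A ψ) = 0
  linearIndependent : LinearIndependent ℂ (fun χ : Λ => restrict A χ)
  span_eq_top : Submodule.span ℂ (restrict A '' Λ) = ⊤

/-- `A` is spectral in the discrete abelian group `G`. -/
def IsSpectral {G : Type*} [AddCommGroup G] (A : Finset G) : Prop :=
  ∃ Λ : Set (AddChar G Circle), IsSpectrum A Λ

/-- `A` tiles the discrete abelian group `G` by translation: for some set `T` of translates, every
point of `G` lies in exactly one of the sets `t + A`, `t ∈ T`. -/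
def Tiles {G : Type*} [AddCommGroup G] (A : Finset G) : Prop :=
  ∃ T : Set G, ∀ x : G, ∃! t : G, t ∈ T ∧ x - t ∈ A

end SpectralTile

/-! A spectrum of `n` points yields `n` characters whose values on `A` form a complex Hadamard
matrix (`IsSpectral.exists_rows`). The quotient `f` of two of them is a homomorphism to the circle,
and `A` tiles once its image does, counted with multiplicity (`tiles_of_map`).

For `n = 2, 3, 5` the map `f` sends `A` bijectively onto a coset of a finite subgroup, and a
transversal of that subgroup pulls back to a tiling set. Since `n` is prime, it is enough that `f`
is injective on `A` and that its image is stable under one nontrivial multiplication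
(`tiles_of_stable`). For `n = 2, 3` this can be read off from the vanishing of the sum of `f` over
`A`.

For `n = 5` this is the rigidity of Hadamard matrices of order five. In a `3 × 3` block, row and
column orthogonality trade three-term sums for two-term sums, whose cyclic products equal those of
their inverted ratios; the two resulting identities add up to a product of differences of diagonal
products. The coincidences so obtained make the values of a row ratio distinct (`fst_injective`) and
symmetric about each of them (`exists_mul_eq_sq`); two such reflections compose to the required
multiplication.

For `n = 4` some row ratio `f` takes two opposite values, twice each (`exists_row_eq_or_eq_neg`). A
further row ratio `g` is opposite within each pair, so a half circle for `f` selects the pair and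
one for `g` the point in it. -/

/-! ### Phase identities for `3 × 3` blocks -/

/-- The two phase conditions on a `3 × 3` array with rows `1`, `x`, `y`, one for its columns and one
for its rows, force two of its three even diagonal products to coincide. -/
theorem diagonal_products_of_phases {F : Type*} [Field F] [CharZero F] {x₁ x₂ x₃ y₁ y₂ y₃ : F}
    (hx₁ : x₁ ≠ 0) (hx₂ : x₂ ≠ 0) (hx₃ : x₃ ≠ 0) (hy₁ : y₁ ≠ 0) (hy₂ : y₂ ≠ 0) (hy₃ : y₃ ≠ 0)
    (hcol : (1 + x₁ / x₂ + y₁ / y₂) * (1 + x₂ / x₃ + y₂ / y₃) * (1 + x₃ / x₁ + y₃ / y₁) =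
      (1 + x₂ / x₁ + y₂ / y₁) * (1 + x₃ / x₂ + y₃ / y₂) * (1 + x₁ / x₃ + y₁ / y₃))
    (hrow : (x₁ + x₂ + x₃) * (y₁ / x₁ + y₂ / x₂ + y₃ / x₃) * (1 / y₁ + 1 / y₂ + 1 / y₃) =
      (1 / x₁ + 1 / x₂ + 1 / x₃) * (x₁ / y₁ + x₂ / y₂ + x₃ / y₃) * (y₁ + y₂ + y₃)) :
    x₂ * y₃ = x₃ * y₁ ∨ x₃ * y₁ = x₁ * y₂ ∨ x₂ * y₃ = x₁ * y₂ := by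
  have key : (x₂ * y₃ - x₃ * y₁) * (x₃ * y₁ - x₁ * y₂) * (x₂ * y₃ - x₁ * y₂) = 0 := by
    field_simp at hcol hrow
    have h2 : (2 : F) ≠ 0 := two_ne_zero
    apply mul_left_cancel₀ h2
    -- Cleared of denominators, the two conditions add up to minus twice the product of the three
    -- differences.
    linear_combination -hcol - hrow
  rcases mul_eq_zero.mp key with h | h
  · rcases mul_eq_zero.mp h with h | h
    · exact Or.inl (sub_eq_zero.mp h)
    · exact Or.inr (Or.inl (sub_eq_zero.mp h))
  · exact Or.inr (Or.inr (sub_eq_zero.mp h))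

/-- A sum of two terms satisfies the phase condition identically. -/
theorem phase_pair {F : Type*} [Field F] {u₁ u₂ u₃ v₁ v₂ v₃ : F}
    (hu₁ : u₁ ≠ 0) (hu₂ : u₂ ≠ 0) (hu₃ : u₃ ≠ 0) (hv₁ : v₁ ≠ 0) (hv₂ : v₂ ≠ 0) (hv₃ : v₃ ≠ 0) :
    (u₁ / u₂ + v₁ / v₂) * (u₂ / u₃ + v₂ / v₃) * (u₃ / u₁ + v₃ / v₁) =
      (u₂ / u₁ + v₂ / v₁) * (u₃ / u₂ + v₃ / v₂) * (u₁ / u₃ + v₁ / v₃) := by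
  field_simp
  ring

/-! ### Stable sets of prime cardinality -/

open Pointwise in
/-- A finite set of prime cardinality stable under translation by `c ≠ 1` is a coset of the
subgroup generated by `c`. -/
theorem mem_iff_div_mem_zpowers_of_card_prime {Q : Type*} [CommGroup Q] [DecidableEq Q]
    {S : Finset Q} (hp : S.card.Prime) {c s : Q} (hc : c ≠ 1) (hS : ∀ z ∈ S, c * z ∈ S) (hs : s ∈ S)
    (z : Q) : z ∈ S ↔ z / s ∈ Subgroup.zpowers c := by
  have hsm : c • S = S := by
    apply Finset.eq_of_subset_of_card_le
    · intro z hz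
      obtain ⟨w, hw, rfl⟩ := Finset.mem_smul_finset.mp hz
      exact hS w hw
    · simp
  have hK : ∀ k ∈ Subgroup.zpowers c, ∀ z ∈ S, z * k ∈ S := by
    intro k hk z hz
    have : Subgroup.zpowers c ≤ MulAction.stabilizer Q S := by
      rw [Subgroup.zpowers_le]; exact hsm
    have h2 : k • S = S := this hk
    rw [← h2, mul_comm]
    exact Finset.smul_mem_smul_finset hz
  have hfin : (Subgroup.zpowers c : Set Q).Finite := by
    apply Set.Finite.of_finite_image (f := fun k => s * k) (S.finite_toSet.subset _)
    · exact (mul_right_injective s).injOn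
    · rintro _ ⟨k, hk, rfl⟩
      exact hK k hk s hs
  set K : Finset Q := hfin.toFinset with hKdef
  have memK : ∀ k, k ∈ K ↔ k ∈ Subgroup.zpowers c := by simp [hKdef]
  -- Stability makes `S` a union of full cosets, so the order of the subgroup divides the prime
  -- `S.card`.
  have hfib : ∀ q ∈ S.image (QuotientGroup.mk : Q → Q ⧸ Subgroup.zpowers c),
      (S.filter fun a => (QuotientGroup.mk a : Q ⧸ Subgroup.zpowers c) = q).card = K.card := by
    intro q hq
    obtain ⟨w, hw, rfl⟩ := Finset.mem_image.mp hq
    symm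
    refine Finset.card_bij (fun k _ => w * k) ?_ ?_ ?_
    · intro k hk
      rw [memK] at hk
      rw [Finset.mem_filter]
      refine ⟨hK k hk w hw, ?_⟩
      rw [eq_comm, QuotientGroup.eq]; simpa using hk
    · intro k _ k' _ h; exact mul_left_cancel h
    · intro a ha
      rw [Finset.mem_filter] at ha
      refine ⟨w⁻¹ * a, ?_, by simp⟩
      rw [memK, ← QuotientGroup.eq]; exact ha.2.symm
  have hdvd : K.card ∣ S.card := by
    rw [Finset.card_eq_sum_card_image (QuotientGroup.mk : Q → Q ⧸ Subgroup.zpowers c) S,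
      Finset.sum_congr rfl hfib, Finset.sum_const, smul_eq_mul]
    exact Dvd.intro_left _ rfl
  have hone : K.card ≠ 1 := by
    intro h
    obtain ⟨k, hk⟩ := Finset.card_eq_one.mp h
    have h1 : (1 : Q) ∈ K := (memK 1).2 (one_mem _)
    have h2 : c ∈ K := (memK c).2 (Subgroup.mem_zpowers c)
    rw [hk, Finset.mem_singleton] at h1 h2
    exact hc (h2.trans h1.symm)
  have hcard : K.card = S.card := ((Nat.dvd_prime hp).mp hdvd).resolve_left hone
  have himg : K.image (fun k => s * k) = S := by
    apply Finset.eq_of_subset_of_card_le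
    · intro z hz
      obtain ⟨k, hk, rfl⟩ := Finset.mem_image.mp hz
      exact hK k ((memK k).1 hk) s hs
    · rw [Finset.card_image_of_injective _ (mul_right_injective s), hcard]
  rw [← himg, Finset.mem_image, ← memK]
  constructor
  · rintro ⟨k, hk, rfl⟩; simpa using hk
  · intro h; exact ⟨_, h, by simp⟩

/-! ### Three rows of order five: distinct entries -/

/-- Two ratio vectors `x`, `y` of three mutually orthogonal unimodular rows of length five such that
each `3 × 3` block has two coinciding even and two coinciding odd diagonal products. -/
structure IsHaagerupTriple (x y : Fin 5 → Circle) : Prop where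
  sum_fst : ∑ j, (x j : ℂ) = 0
  sum_snd : ∑ j, (y j : ℂ) = 0
  sum_div : ∑ j, ((y j / x j : Circle) : ℂ) = 0
  diag : ∀ j k l, j ≠ k → k ≠ l → j ≠ l →
    x k * y l = x l * y j ∨ x l * y j = x j * y k ∨ x k * y l = x j * y k

theorem Circle.sum_inv_eq_zero {ι : Type*} {s : Finset ι} {z : ι → Circle}
    (h : ∑ j ∈ s, (z j : ℂ) = 0) : ∑ j ∈ s, (((z j)⁻¹ : Circle) : ℂ) = 0 := by
  simp only [Circle.coe_inv_eq_conj]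
  rw [← map_sum, h, map_zero]

/-- Three equal terms have a sum of modulus 3, which the other two cannot cancel. -/
theorem Circle.not_three_eq_of_sum_eq_zero {z : Fin 5 → Circle} (h : ∑ j, (z j : ℂ) = 0)
    {i j k : Fin 5} (hij : i ≠ j) (hik : i ≠ k) (hjk : j ≠ k) (h₁ : z i = z j) (h₂ : z i = z k) :
    False := by
  have hc : ({i, j, k} : Finset (Fin 5)).card = 3 := Finset.card_eq_three.2 ⟨i, j, k, hij, hik, hjk, rfl⟩
  have hs := Finset.sum_add_sum_compl ({i, j, k} : Finset (Fin 5)) (fun j => (z j : ℂ))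
  rw [h, Finset.sum_insert (by simp [hij, hik]), Finset.sum_pair hjk, ← h₁, ← h₂] at hs
  have hn : ‖∑ m ∈ ({i, j, k} : Finset (Fin 5))ᶜ, (z m : ℂ)‖ ≤ 2 := by
    refine (norm_sum_le _ _).trans ?_
    simp only [Circle.norm_coe, Finset.sum_const, Finset.card_compl, hc]
    norm_num
  rw [show ∑ m ∈ ({i, j, k} : Finset (Fin 5))ᶜ, (z m : ℂ) = -(3 * z i) by linear_combination hs] at hn
  rw [norm_neg, norm_mul, Circle.norm_coe] at hn
  norm_num at hn

/-- Subtracting the conjugate equation would make `z` real, so `z ^ 2 = 1`, against `2 + 3 * z = 0`.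
-/
theorem Circle.two_add_two_mul_add_inv_ne_zero (z : Circle) :
    (2 + 2 * z + (z⁻¹ : Circle) : ℂ) ≠ 0 := by
  intro h
  have h' := congrArg (starRingEnd ℂ) h
  simp only [map_add, map_mul, map_ofNat, map_zero, ← Circle.coe_inv_eq_conj, inv_inv] at h'
  have h1 : (z : ℂ) * (z⁻¹ : Circle) = 1 := by simp
  have h2 : (z : ℂ) = (z⁻¹ : Circle) := by linear_combination h - h'
  rw [← h2] at h h1
  have : (4 : ℂ) = 9 := by linear_combination (2 - 3 * (z : ℂ)) * h + 9 * h1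
  norm_num at this

namespace IsHaagerupTriple

variable {x y : Fin 5 → Circle}

theorem swap (h : IsHaagerupTriple x y) : IsHaagerupTriple y x where
  sum_fst := h.sum_snd
  sum_snd := h.sum_fst
  sum_div := by simpa using Circle.sum_inv_eq_zero h.sum_div
  diag j k l hjk hkl hjl := by
    have := h.diag j l k hjl hkl.symm hjk
    simp only [mul_comm (y _)]
    tauto

/-- The rows `1, x, y` are permuted cyclically and divided by the new first row `x`; this carries
facts about `x` over to `y / x`. -/
theorem rotate (h : IsHaagerupTriple x y) : IsHaagerupTriple (y / x) x⁻¹ where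
  sum_fst := h.sum_div
  sum_snd := Circle.sum_inv_eq_zero h.sum_fst
  sum_div := by
    have e : ∀ j, x⁻¹ j / (y / x) j = (y j)⁻¹ := fun j => by
      rw [Pi.inv_apply, Pi.div_apply, div_eq_iff_eq_mul, ← mul_div_assoc, inv_mul_cancel, one_div]
    simpa only [e] using Circle.sum_inv_eq_zero h.sum_snd
  diag j k l hjk hkl hjl := by
    have e : ∀ a b c : Fin 5, (y / x) a * x⁻¹ b = x c * y a / (x a * x b * x c) := by
      intro a b c
      simp only [Pi.div_apply, Pi.inv_apply]
      rw [← div_eq_mul_inv, div_div, mul_comm (x c), mul_div_mul_right_eq_div]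
    rw [e k l j, e l j k, e j k l, show x l * x j * x k = x k * x l * x j by ac_rfl,
      show x j * x k * x l = x k * x l * x j by ac_rfl,
      div_left_inj, div_left_inj, div_left_inj]
    have := h.diag j k l hjk hkl hjl
    tauto

theorem comp (h : IsHaagerupTriple x y) (e : Equiv.Perm (Fin 5)) :
    IsHaagerupTriple (x ∘ e) (y ∘ e) where
  sum_fst := (Equiv.sum_comp e fun j => (x j : ℂ)).trans h.sum_fst
  sum_snd := (Equiv.sum_comp e fun j => (y j : ℂ)).trans h.sum_snd
  sum_div := (Equiv.sum_comp e fun j => ((y j / x j : Circle) : ℂ)).trans h.sum_div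
  diag _ _ _ hjk hkl hjl := h.diag _ _ _ (e.injective.ne hjk) (e.injective.ne hkl)
    (e.injective.ne hjl)

theorem smul (h : IsHaagerupTriple x y) (c d : Circle) :
    IsHaagerupTriple (fun j => c * x j) (fun j => d * y j) where
  sum_fst := by simp [← Finset.mul_sum, h.sum_fst]
  sum_snd := by simp [← Finset.mul_sum, h.sum_snd]
  sum_div := by
    simp_rw [mul_div_mul_comm, Circle.coe_mul]
    rw [← Finset.mul_sum, h.sum_div, mul_zero]
  diag j k l hjk hkl hjl := by
    simp only [mul_mul_mul_comm c, mul_right_inj]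
    exact h.diag j k l hjk hkl hjl

theorem not_normalized (h : IsHaagerupTriple x y) (hx₀ : x 0 = 1) (hx₁ : x 1 = 1)
    (hy₀ : y 0 = 1) : False := by
  have hx : ∀ l, 0 ≠ l → 1 ≠ l → x l ≠ 1 := fun l h0 h1 hl =>
    Circle.not_three_eq_of_sum_eq_zero h.sum_fst (zero_ne_one) h0 h1 (hx₀.trans hx₁.symm)
      (hx₀.trans hl.symm)
  have hd : ∀ l, 0 ≠ l → 1 ≠ l → (y l = x l ∨ x l = y 1 ∨ y l = y 1) ∧
      (x l * y 1 = 1 ∨ 1 = y l ∨ x l * y 1 = y l) := by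
    intro l h0 h1
    have e1 := h.diag 0 1 l zero_ne_one h1 h0
    have e2 := h.diag 0 l 1 h0 h1.symm zero_ne_one
    simpa [hx₀, hx₁, hy₀] using And.intro e1 e2
  by_cases hβ : y 1 = 1
  · have hy : ∀ l, 0 ≠ l → 1 ≠ l → y l / x l = 1 := by
      intro l h0 h1
      rcases (hd l h0 h1).1 with e | e | e
      · rw [e, div_self']
      · exact absurd (e.trans hβ) (hx l h0 h1)
      · exact (Circle.not_three_eq_of_sum_eq_zero h.sum_snd (zero_ne_one) h0 h1
          (hy₀.trans hβ.symm) (hy₀.trans (e.trans hβ).symm)).elim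
    refine Circle.not_three_eq_of_sum_eq_zero h.sum_div (i := 2) (j := 3) (k := 4)
      (by decide) (by decide) (by decide) ?_ ?_ <;>
    rw [hy _ (by decide) (by decide), hy _ (by decide) (by decide)]
  -- Otherwise the last three entries of `x` lie in `{y 1, (y 1)⁻¹}`; they are not all equal, so the
  -- sum is `2 + 2 * z + z⁻¹` with `z = y 1` or its inverse.
  · have hval : ∀ l, 0 ≠ l → 1 ≠ l → x l = y 1 ∨ x l = (y 1)⁻¹ := by
      intro l h0 h1
      have hl := hx l h0 h1
      rcases hd l h0 h1 with ⟨e | e | e, f⟩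
      · rw [e] at f
        rcases f with f | f | f
        · exact Or.inr (eq_inv_of_mul_eq_one_left f)
        · exact absurd f.symm hl
        · exact absurd (mul_eq_left.mp f) hβ
      · exact Or.inl e
      · rw [e] at f
        rcases f with f | f | f
        · exact Or.inr (eq_inv_of_mul_eq_one_left f)
        · exact absurd f.symm hβ
        · exact absurd (mul_eq_right.mp f) hl
    have hsum := h.sum_fst
    have hthree := Circle.not_three_eq_of_sum_eq_zero h.sum_fst (i := 2) (j := 3) (k := 4)
      (by decide) (by decide) (by decide)
    rw [Fin.sum_univ_five] at hsum
    have n1 := Circle.two_add_two_mul_add_inv_ne_zero (y 1)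
    have n2 := Circle.two_add_two_mul_add_inv_ne_zero (y 1)⁻¹
    rw [inv_inv] at n2
    rw [hx₀, hx₁, Circle.coe_one] at hsum
    rcases hval 2 (by decide) (by decide) with e2 | e2 <;>
    rcases hval 3 (by decide) (by decide) with e3 | e3 <;>
    rcases hval 4 (by decide) (by decide) with e4 | e4 <;>
    rw [e2, e3, e4] at hsum hthree <;>
    first
    | exact hthree rfl rfl
    | exact n1 (by linear_combination hsum)
    | exact n2 (by linear_combination hsum)

theorem fst_injective (h : IsHaagerupTriple x y) : Function.Injective x := by
  intro j k hjk
  by_contra hne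
  -- `m` is chosen so that `e` below sends 0 to `j` and 1 to `k`.
  set m := Equiv.swap 0 j k with hm
  have hm0 : m ≠ 0 := by
    intro h0
    rw [hm, Equiv.swap_apply_eq_iff, Equiv.swap_apply_left] at h0
    exact hne h0.symm
  set e : Equiv.Perm (Fin 5) := Equiv.swap 0 j * Equiv.swap 1 m with he
  have e0 : e 0 = j := by
    rw [he, Equiv.Perm.mul_apply, Equiv.swap_apply_of_ne_of_ne zero_ne_one hm0.symm,
      Equiv.swap_apply_left]
  have e1 : e 1 = k := by
    rw [he, Equiv.Perm.mul_apply, Equiv.swap_apply_left, hm, Equiv.swap_apply_self]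
  refine ((h.comp e).smul (x j)⁻¹ (y j)⁻¹).not_normalized ?_ ?_ ?_ <;> simp [e0, e1, hjk]

end IsHaagerupTriple

theorem Finset.exists_of_three_cover {α : Type*} [DecidableEq α] {s : Finset α} (hs : s.card = 3)
    {p q r : α → Prop} (hpqr : ∀ k ∈ s, p k ∨ q k ∨ r k)
    (hp : ∀ k ∈ s, ∀ l ∈ s, p k → p l → k = l) (hq : ∀ k ∈ s, ∀ l ∈ s, q k → q l → k = l)
    (hr : ∀ k ∈ s, ∀ l ∈ s, r k → r l → k = l) :
    (∃ k ∈ s, p k) ∧ (∃ k ∈ s, q k) ∧ ∃ k ∈ s, r k := by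
  classical
  have key : ∀ t : α → Prop, (∀ k ∈ s, ∀ l ∈ s, t k → t l → k = l) →
      (s.filter t).card ≤ 1 ∧ ((s.filter t).card = 1 → ∃ k ∈ s, t k) := by
    intro t ht
    constructor
    · rw [Finset.card_le_one]
      simp only [Finset.mem_filter]
      rintro a ⟨ha, ta⟩ b ⟨hb, tb⟩
      exact ht a ha b hb ta tb
    · intro h
      obtain ⟨k, hk⟩ := Finset.card_pos.mp (h ▸ Nat.one_pos)
      exact ⟨k, (Finset.mem_filter.mp hk).1, (Finset.mem_filter.mp hk).2⟩
  have hcov : s = s.filter p ∪ s.filter q ∪ s.filter r := by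
    ext k
    simp only [Finset.mem_union, Finset.mem_filter]
    have := hpqr k
    tauto
  have h1 := Finset.card_union_le (s.filter p ∪ s.filter q) (s.filter r)
  have h2 := Finset.card_union_le (s.filter p) (s.filter q)
  rw [← hcov, hs] at h1
  obtain ⟨p1, p2⟩ := key p hp
  obtain ⟨q1, q2⟩ := key q hq
  obtain ⟨r1, r2⟩ := key r hr
  exact ⟨p2 (by omega), q2 (by omega), r2 (by omega)⟩

/-! ### Three rows of order five: reflections and a translation -/

namespace IsHaagerupTriple

variable {x y : Fin 5 → Circle}

/-- Each of the three remaining columns satisfies one of three coincidences. These fix `x k`, `y k`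
and `y k / x k` respectively, and all three vectors are injective, so each coincidence occurs
exactly once among those columns. -/
theorem exists_of_base (h : IsHaagerupTriple x y) {o l : Fin 5} (hol : o ≠ l) :
    (∃ k, o ≠ k ∧ x k * y l = x l * y o) ∧ (∃ k, o ≠ k ∧ x l * y o = x o * y k) ∧
      ∃ k, o ≠ k ∧ x k * y l = x o * y k := by
  have hx := h.fst_injective
  have hy := h.swap.fst_injective
  have hyx := h.rotate.fst_injective
  have hcard : ({o, l}ᶜ : Finset (Fin 5)).card = 3 := by
    rw [Finset.card_compl, Finset.card_pair hol]; rfl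
  have hmem : ∀ k, k ∈ ({o, l}ᶜ : Finset (Fin 5)) → o ≠ k ∧ k ≠ l := by
    intro k hk
    simp only [Finset.mem_compl, Finset.mem_insert, Finset.mem_singleton, not_or] at hk
    exact ⟨Ne.symm hk.1, hk.2⟩
  obtain ⟨⟨a, ha, ha'⟩, ⟨b, hb, hb'⟩, c, hc, hc'⟩ := Finset.exists_of_three_cover hcard
    (p := fun k => x k * y l = x l * y o) (q := fun k => x l * y o = x o * y k)
    (r := fun k => x k * y l = x o * y k)
    (fun k hk => h.diag o k l (hmem k hk).1 (hmem k hk).2 hol)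
    (fun k _ m _ e f => hx (mul_right_cancel (e.trans f.symm)))
    (fun k _ m _ e f => hy (mul_left_cancel (e.symm.trans f)))
    (fun k _ m _ e f => hyx (by
      have : ∀ k, x k * y l = x o * y k → (y / x) k = y l / x o := by
        intro k e
        rw [Pi.div_apply, div_eq_div_iff_mul_eq_mul, mul_comm, ← e, mul_comm]
      rw [this k e, this m f]))
  exact ⟨⟨a, (hmem a ha).1, ha'⟩, ⟨b, (hmem b hb).1, hb'⟩, c, (hmem c hc).1, hc'⟩

theorem exists_mul_eq_sq (h : IsHaagerupTriple x y) (o l : Fin 5) :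
    ∃ n, x n * x l = x o * x o := by
  rcases eq_or_ne o l with rfl | hol
  · exact ⟨o, rfl⟩
  -- Scaled to `x o = y o = 1`, the relations read `x l = y m`, `x k * y m = y k`, `x n * y k = x
  -- k`, whence `x n = 1 / x l`.
  obtain ⟨-, ⟨m, hm, em⟩, -⟩ := h.exists_of_base hol
  obtain ⟨-, -, k, hk, ek⟩ := h.exists_of_base hm
  obtain ⟨⟨n, -, en⟩, -, -⟩ := h.exists_of_base hk
  refine ⟨n, ?_⟩
  apply mul_right_cancel (b := y k * y m * y o)
  calc x n * x l * (y k * y m * y o) = (x n * y k) * (x l * y o) * y m := by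
        simp only [mul_comm, mul_left_comm]
    _ = x o * y o * y m * (x k * y m) := by rw [en, em]; simp only [mul_comm, mul_left_comm]
    _ = _ := by rw [ek]; simp only [mul_comm, mul_left_comm]

/-- Reflecting the values of `x` about `x 0` and then about `x p` multiplies them by `(x p / x 0) ^
2`. This is not 1 for every `p`, as five distinct values cannot all be `± x 0`. -/
theorem exists_stable (h : IsHaagerupTriple x y) :
    ∃ c : Circle, c ≠ 1 ∧ ∀ l, ∃ n, x n = c * x l := by
  have hx := h.fst_injective
  obtain ⟨p, hp⟩ : ∃ p, (x p / x 0) ^ 2 ≠ 1 := by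
    by_contra! hall
    have hpm : ∀ p, p ≠ 0 → (x p : ℂ) = -x 0 := by
      intro p hp
      have h1 := hall p
      rw [div_pow, div_eq_one] at h1
      have h2 : (x p : ℂ) ^ 2 = (x 0 : ℂ) ^ 2 := by
        simpa using congrArg (fun z : Circle => (z : ℂ)) h1
      rcases sq_eq_sq_iff_eq_or_eq_neg.mp h2 with h3 | h3
      · exact absurd (hx (Circle.ext h3)) hp
      · exact h3
    have : (1 : Fin 5) = 2 :=
      hx (Circle.ext ((hpm 1 (by decide)).trans (hpm 2 (by decide)).symm))
    exact absurd this (by decide)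
  refine ⟨_, hp, fun l => ?_⟩
  obtain ⟨m, hm⟩ := h.exists_mul_eq_sq 0 l
  obtain ⟨n, hn⟩ := h.exists_mul_eq_sq p m
  refine ⟨n, ?_⟩
  rw [← mul_right_cancel_iff (a := x m), hn, mul_assoc, mul_comm (x l), hm, div_pow, ← sq, ← sq,
    div_mul_cancel]

end IsHaagerupTriple


/-! ### Complex Hadamard matrices of order five -/

/-- The rows of a complex Hadamard matrix being orthogonal, so are its columns. -/
theorem Circle.sum_div_col_eq_zero {ι : Type*} [Fintype ι] [DecidableEq ι] {H : ι → ι → Circle}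
    (hH : ∀ i i', i ≠ i' → ∑ j, ((H i j / H i' j : Circle) : ℂ) = 0) {j j' : ι} (hj : j ≠ j') :
    ∑ i, ((H i j / H i j' : Circle) : ℂ) = 0 := by
  have hn : (Fintype.card ι : ℂ) ≠ 0 := by
    have : Nonempty ι := ⟨j⟩
    exact_mod_cast Fintype.card_ne_zero
  set M : Matrix ι ι ℂ := Matrix.of fun i j => (H i j : ℂ) with hM
  have h1 : M * ((Fintype.card ι : ℂ)⁻¹ • M.conjTranspose) = 1 := by
    ext i i'
    rw [Matrix.mul_smul, Matrix.smul_apply, Matrix.mul_apply]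
    simp only [hM, Matrix.conjTranspose_apply, Matrix.of_apply, RCLike.star_def,
      ← Circle.coe_inv_eq_conj, ← Circle.coe_mul, ← div_eq_mul_inv]
    rcases eq_or_ne i i' with rfl | hi
    · simp [hn]
    · rw [hH i i' hi, Matrix.one_apply_ne hi, smul_zero]
  have h1' : ((Fintype.card ι : ℂ)⁻¹ • M.conjTranspose) * M = 1 := mul_eq_one_comm.mp h1
  have h2 := congrFun (congrFun h1' j') j
  rw [Matrix.smul_mul, Matrix.smul_apply, Matrix.mul_apply, Matrix.one_apply_ne hj.symm] at h2
  simp only [hM, Matrix.conjTranspose_apply, Matrix.of_apply, RCLike.star_def,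
    ← Circle.coe_inv_eq_conj, ← Circle.coe_mul, ← div_eq_inv_mul] at h2
  exact (smul_eq_zero.mp h2).resolve_left (inv_ne_zero hn)

/-- Any three rows of a complex Hadamard matrix of order five, the first of them scaled to `1`. -/
theorem isHaagerupTriple_of_rows {H : Fin 5 → Fin 5 → Circle}
    (hH : ∀ i i', i ≠ i' → ∑ j, ((H i j / H i' j : Circle) : ℂ) = 0) :
    IsHaagerupTriple (fun j => H 1 j / H 0 j) (fun j => H 2 j / H 0 j) where
  sum_fst := hH 1 0 (by decide)
  sum_snd := hH 2 0 (by decide)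
  sum_div := by simpa using hH 2 1 (by decide)
  diag j k l hjk hkl hjl := by
    have hc : ({j, k, l} : Finset (Fin 5)).card = 3 :=
      Finset.card_eq_three.2 ⟨j, k, l, hjk, hjl, hkl, rfl⟩
    obtain ⟨m, n, hmn, hcompl⟩ : ∃ m n, m ≠ n ∧ ({j, k, l} : Finset (Fin 5))ᶜ = {m, n} := by
      rw [← Finset.card_eq_two, Finset.card_compl, hc]; rfl
    have hsplit : ∀ f : Fin 5 → ℂ, f j + f k + f l = ∑ i, f i - (f m + f n) := by
      intro f
      rw [← Finset.sum_add_sum_compl ({j, k, l} : Finset (Fin 5)) f, hcompl,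
        Finset.sum_insert (by simp [hjk, hjl]), Finset.sum_pair hkl, Finset.sum_pair hmn]
      ring
    set x : Fin 5 → ℂ := fun j => ((H 1 j / H 0 j : Circle) : ℂ) with hx
    set y : Fin 5 → ℂ := fun j => ((H 2 j / H 0 j : Circle) : ℂ) with hy
    set u : Fin 5 → ℂ := fun j => ((H 3 j / H 0 j : Circle) : ℂ) with hu
    set v : Fin 5 → ℂ := fun j => ((H 4 j / H 0 j : Circle) : ℂ) with hv
    have hx0 : ∀ j, x j ≠ 0 := fun j => Circle.coe_ne_zero _
    have hy0 : ∀ j, y j ≠ 0 := fun j => Circle.coe_ne_zero _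
    have hu0 : ∀ j, u j ≠ 0 := fun j => Circle.coe_ne_zero _
    have hv0 : ∀ j, v j ≠ 0 := fun j => Circle.coe_ne_zero _
    -- Column orthogonality expresses rows 0, 1, 2 through rows 3, 4; `e` below does the same for
    -- columns `j, k, l` against `m, n`.
    have hcol : ∀ a b, a ≠ b →
        1 + x a / x b + y a / y b = -(u a / u b + v a / v b) := by
      intro a b hab
      have h := Circle.sum_div_col_eq_zero hH hab
      rw [Fin.sum_univ_five] at h
      simp only [hx, hy, hu, hv, Circle.coe_div] at h ⊢
      have h0 := Circle.coe_ne_zero (H 0 a)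
      have h0' := Circle.coe_ne_zero (H 0 b)
      simp only [div_div_div_eq, mul_comm _ (H 0 b : ℂ), mul_div_mul_comm]
      rw [← sub_eq_zero] at h ⊢
      have : (H 0 a : ℂ) / H 0 b * ((H 0 b : ℂ) / H 0 a) = 1 := by field_simp
      linear_combination (H 0 b / H 0 a : ℂ) * h - this
    have key : x k * y l = x l * y j ∨ x l * y j = x j * y k ∨ x k * y l = x j * y k := by
      apply diagonal_products_of_phases (hx0 j) (hx0 k) (hx0 l) (hy0 j) (hy0 k) (hy0 l)
      · rw [hcol _ _ hjk, hcol _ _ hkl, hcol _ _ hjl.symm, hcol _ _ hjk.symm, hcol _ _ hkl.symm,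
          hcol _ _ hjl]
        linear_combination -phase_pair (hu0 j) (hu0 k) (hu0 l) (hv0 j) (hv0 k) (hv0 l)
      · have e : ∀ f : Fin 5 → ℂ, ∑ i, f i = 0 → f j + f k + f l = -(f m + f n) := by
          intro f h
          rw [hsplit, h, zero_sub]
        have e1 := e x (hH 1 0 (by decide))
        have e2 := e y (hH 2 0 (by decide))
        have e3 := e (fun j => y j / x j)
          (by simpa only [hx, hy, ← Circle.coe_div, div_div_div_cancel_right] using hH 2 1 (by decide))
        have e4 := e (fun j => x j / y j)
          (by simpa only [hx, hy, ← Circle.coe_div, div_div_div_cancel_right] using hH 1 2 (by decide))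
        have e5 := e (fun j => 1 / x j)
          (by simpa [hx] using hH 0 1 (by decide))
        have e6 := e (fun j => 1 / y j)
          (by simpa [hy] using hH 0 2 (by decide))
        rw [e1, e2, e3, e4, e5, e6]
        have := hx0 m
        have := hx0 n
        have := hy0 m
        have := hy0 n
        field_simp
        ring
    simpa only [hx, hy, ← Circle.coe_mul, Circle.coe_inj] using key

/-! ### Tilings pulled back along homomorphisms -/

namespace SpectralTile

variable {G Q : Type*} [AddCommGroup G] [CommGroup Q] {A : Finset G} {f : G → Q}

/-- A set tiles as soon as its image, counted with multiplicity, under a homomorphism does. -/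
theorem tiles_of_map (hf : ∀ x y, f (x - y) = f x / f y) (T : Set Q)
    (hT : ∀ x, ∃! a : A, f x / f a ∈ T) : Tiles A := by
  refine ⟨f ⁻¹' T, fun x => ?_⟩
  obtain ⟨a, ha, hu⟩ := hT x
  refine ⟨x - a, ⟨by simpa [hf] using ha, by simp⟩, ?_⟩
  rintro t ⟨ht, htA⟩
  have := hu ⟨x - t, htA⟩ (by simpa [hf] using ht)
  rw [← this]
  simp

/-- A set of prime cardinality tiles if a homomorphism is injective on it and its image is stable
under a nontrivial translation. -/
theorem tiles_of_stable {n : ℕ} (hn : n.Prime) (p : Fin n ≃ A)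
    (hf : ∀ x y, f (x - y) = f x / f y) (hinj : Function.Injective fun j => f (p j)) {c : Q}
    (hc : c ≠ 1) (hS : ∀ j, ∃ k, f (p k) = c * f (p j)) : Tiles A := by
  classical
  set j₀ : Fin n := ⟨0, hn.pos⟩
  have hmem := mem_iff_div_mem_zpowers_of_card_prime
    (S := Finset.univ.image fun j => f (p j)) (s := f (p j₀))
    (by rw [Finset.card_image_of_injective _ hinj]; simpa using hn) hc
    (by
      intro z hz
      obtain ⟨j, -, rfl⟩ := Finset.mem_image.mp hz
      obtain ⟨k, hk⟩ := hS j
      exact Finset.mem_image.mpr ⟨k, Finset.mem_univ _, hk⟩)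
    (Finset.mem_image_of_mem _ (Finset.mem_univ _))
  obtain ⟨T, hT, -⟩ := Subgroup.exists_isComplement_right (Subgroup.zpowers c) 1
  refine tiles_of_map hf T fun x => ?_
  obtain ⟨⟨k, t⟩, hkt, hu⟩ := hT.existsUnique (f x / f (p j₀))
  obtain ⟨j, -, hj⟩ := Finset.mem_image.mp
    ((hmem (f (p j₀) * k)).mpr (by simp))
  refine ⟨p j, ?_, fun a ha => ?_⟩
  · simp only [hj]
    rw [← div_div, ← hkt, mul_div_cancel_left]
    exact t.2
  · have hak : f a / f (p j₀) ∈ Subgroup.zpowers c :=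
      (hmem _).mp (Finset.mem_image.mpr ⟨p.symm a, Finset.mem_univ _, by simp⟩)
    have h := hu (⟨_, hak⟩, ⟨_, ha⟩) (by simp [mul_comm])
    apply p.symm.injective
    apply hinj
    simp only [Equiv.apply_symm_apply, Equiv.symm_apply_apply, hj]
    rw [← congrArg (fun q => (q.1 : Q)) h]
    simp

end SpectralTile

theorem Circle.exists_half : ∃ T : Set Circle, ∀ z, (z ∈ T ∧ -z ∉ T) ∨ (z ∉ T ∧ -z ∈ T) := by
  refine ⟨{z | 0 < (z : ℂ).im ∨ ((z : ℂ).im = 0 ∧ 0 < (z : ℂ).re)}, fun z => ?_⟩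
  simp only [Set.mem_ofPred_eq, Circle.coe_neg, Complex.neg_im, Complex.neg_re]
  rcases lt_trichotomy (z : ℂ).im 0 with h | h | h
  · right; constructor
    · rintro (h' | h') <;> linarith
    · left; linarith
  · have hre : (z : ℂ).re ≠ 0 := fun h' => Circle.coe_ne_zero z (Complex.ext h' h)
    rcases lt_or_gt_of_ne hre with h' | h'
    · right; simp [h, h'.le, h']
    · left; simp [h, h'.le, h']
  · left; constructor
    · exact Or.inl h
    · rintro (h' | h') <;> linarith

namespace SpectralTile

variable {G : Type*} [AddCommGroup G] {A : Finset G} {f g : G → Circle}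

theorem tiles_of_two_pairs (p : Fin 4 ≃ A) (hf : ∀ x y, f (x - y) = f x / f y)
    (hg : ∀ x y, g (x - y) = g x / g y) (hf₁ : f (p 1) = f (p 0)) (hf₂ : f (p 2) = -f (p 0))
    (hf₃ : f (p 3) = -f (p 0)) (hg₁ : g (p 1) = -g (p 0)) (hg₃ : g (p 3) = -g (p 2)) :
    Tiles A := by
  obtain ⟨T, hT⟩ := Circle.exists_half
  -- `T` contains exactly one of each antipodal pair: the first factor selects `{0, 1}` or `{2, 3}`,
  -- the second one index of that pair.
  refine tiles_of_map (f := fun x => (f x, g x)) (fun x y => by simp [hf, hg]) (T ×ˢ T) fun x => ?_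
  suffices h : ∃! j, f x / f (p j) ∈ T ∧ g x / g (p j) ∈ T by
    obtain ⟨j, hj, hu⟩ := h
    refine ⟨p j, hj, fun a ha => ?_⟩
    rw [← hu (p.symm a) (by simpa using ha), Equiv.apply_symm_apply]
  have e₁ : f x / f (p 1) = f x / f (p 0) := by rw [hf₁]
  have e₂ : f x / f (p 2) = -(f x / f (p 0)) := by rw [hf₂, div_neg]
  have e₃ : f x / f (p 3) = -(f x / f (p 0)) := by rw [hf₃, div_neg]
  have e₄ : g x / g (p 1) = -(g x / g (p 0)) := by rw [hg₁, div_neg]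
  have e₅ : g x / g (p 3) = -(g x / g (p 2)) := by rw [hg₃, div_neg]
  have main : ∀ P : Fin 4 → Prop, ((P 0 ∧ ¬P 1 ∨ ¬P 0 ∧ P 1) ∧ ¬P 2 ∧ ¬P 3) ∨
      ((P 2 ∧ ¬P 3 ∨ ¬P 2 ∧ P 3) ∧ ¬P 0 ∧ ¬P 1) → ∃! j, P j := by
    rintro P (⟨⟨h₀, h₁⟩ | ⟨h₀, h₁⟩, h₂, h₃⟩ | ⟨⟨h₂, h₃⟩ | ⟨h₂, h₃⟩, h₀, h₁⟩)
    · exact ⟨0, h₀, fun j hj => by fin_cases j <;> first | rfl | contradiction⟩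
    · exact ⟨1, h₁, fun j hj => by fin_cases j <;> first | rfl | contradiction⟩
    · exact ⟨2, h₂, fun j hj => by fin_cases j <;> first | rfl | contradiction⟩
    · exact ⟨3, h₃, fun j hj => by fin_cases j <;> first | rfl | contradiction⟩
  apply main
  rw [e₁, e₂, e₃, e₄, e₅]
  have h₁ := hT (f x / f (p 0))
  have h₂ := hT (g x / g (p 0))
  have h₃ := hT (g x / g (p 2))
  tauto

end SpectralTile

/-! ### Complex Hadamard matrices of order four -/

/-- Four numbers `1, a, b, c` with vanishing sum and vanishing sum of inverses form two opposite
pairs. -/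
theorem opposite_pairs_of_sum_eq_zero {F : Type*} [Field F] {a b c : F} (ha : a ≠ 0) (hb : b ≠ 0)
    (hc : c ≠ 0) (h : 1 + a + b + c = 0) (h' : 1 + 1 / a + 1 / b + 1 / c = 0) :
    (a = -1 ∧ c = -b) ∨ (b = -1 ∧ c = -a) ∨ (c = -1 ∧ b = -a) := by
  field_simp at h'
  have key : (a + 1) * (b + 1) * (c + 1) = 0 := by linear_combination h + h'
  rcases mul_eq_zero.mp key with k | k
  · rcases mul_eq_zero.mp k with k | k
    · exact Or.inl ⟨by linear_combination k, by linear_combination h - k⟩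
    · exact Or.inr (Or.inl ⟨by linear_combination k, by linear_combination h - k⟩)
  · exact Or.inr (Or.inr ⟨by linear_combination k, by linear_combination h - k⟩)

/-- Two orthogonal rows of order four: one of them is real or they have `-1` in the same column and
are opposite in the remaining two. -/
theorem real_or_opposite_of_orthogonal {F : Type*} [Field F] [CharZero F] {a b c a' b' c' : F}
    (ha : a ≠ 0) (hb : b ≠ 0) (hc : c ≠ 0) (ha' : a' ≠ 0) (hb' : b' ≠ 0) (hc' : c' ≠ 0)
    (h₁ : 1 + a + b + c = 0) (h₂ : 1 + 1 / a + 1 / b + 1 / c = 0)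
    (h₁' : 1 + a' + b' + c' = 0) (h₂' : 1 + 1 / a' + 1 / b' + 1 / c' = 0)
    (h : 1 + a / a' + b / b' + c / c' = 0) :
    (a ^ 2 = 1 ∧ b ^ 2 = 1 ∧ c ^ 2 = 1) ∨ (a' ^ 2 = 1 ∧ b' ^ 2 = 1 ∧ c' ^ 2 = 1) ∨
      (a = -1 ∧ a' = -1 ∧ c = -b ∧ c' = -b' ∧ b' = -b) ∨
      (b = -1 ∧ b' = -1 ∧ c = -a ∧ c' = -a' ∧ a' = -a) ∨
      (c = -1 ∧ c' = -1 ∧ b = -a ∧ b' = -a' ∧ a' = -a) := by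
  have same : ∀ s t : F, t ≠ 0 → 1 + s / t + (1 + s / t) = 0 → t = -s := by
    intro s t ht e
    have : (2 : F) ≠ 0 := two_ne_zero
    field_simp at e
    exact mul_left_cancel₀ this (by linear_combination e)
  -- With the entries `-1` in different columns, orthogonality factors as `(s - 1) * (t - 1) = 0`,
  -- so one row is real.
  have diff : ∀ s t : F, t ≠ 0 → 1 - 1 / t - s + s / t = 0 → s ^ 2 = 1 ∨ t ^ 2 = 1 := by
    intro s t ht e
    field_simp at e
    rcases mul_eq_zero.mp (show (s - 1) * (t - 1) = 0 by linear_combination -e) with k | k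
    · exact Or.inl (by rw [sub_eq_zero.mp k, one_pow])
    · exact Or.inr (by rw [sub_eq_zero.mp k, one_pow])
  rcases opposite_pairs_of_sum_eq_zero ha hb hc h₁ h₂ with ⟨rfl, rfl⟩ | ⟨rfl, rfl⟩ | ⟨rfl, rfl⟩ <;>
  rcases opposite_pairs_of_sum_eq_zero ha' hb' hc' h₁' h₂' with
    ⟨rfl, rfl⟩ | ⟨rfl, rfl⟩ | ⟨rfl, rfl⟩ <;>
  simp only [div_neg, neg_div, neg_neg, div_one] at h
  · have := same b b' hb' (by linear_combination h); simp [this]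
  · have k := diff b a' ha' (by linear_combination h)
    simp only [neg_sq, one_pow] at k ⊢
    tauto
  · have k := diff (-b) a' ha' (by simp only [neg_div]; linear_combination h)
    simp only [neg_sq, one_pow] at k ⊢
    tauto
  · have k := diff a b' hb' (by linear_combination h)
    simp only [neg_sq, one_pow] at k ⊢
    tauto
  · have := same a a' ha' (by linear_combination h); simp [this]
  · have k := diff (-a) (-a') (neg_ne_zero.mpr ha') (by simp only [div_neg, neg_div, neg_neg]; linear_combination h)
    simp only [neg_sq, one_pow] at k ⊢
    tauto
  · have k := diff a (-b') (neg_ne_zero.mpr hb') (by simp only [div_neg]; linear_combination h)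
    simp only [neg_sq, one_pow] at k ⊢
    tauto
  · have k := diff (-a) (-a') (neg_ne_zero.mpr ha') (by simp only [div_neg, neg_div, neg_neg]; linear_combination h)
    simp only [neg_sq, one_pow] at k ⊢
    tauto
  · have := same a a' ha' (by linear_combination h); simp [this]

/-- The Hadamard matrices of order four have a row with ratio `±1` to the first one. -/
theorem exists_real_row {F : Type*} [Field F] [CharZero F] {x : Fin 3 → Fin 4 → F}
    (hx₀ : ∀ i, x i 0 = 1) (hx : ∀ i j, x i j ≠ 0) (h : ∀ i, ∑ j, x i j = 0)
    (h' : ∀ i, ∑ j, 1 / x i j = 0) (hd : ∀ i i', i ≠ i' → ∑ j, x i j / x i' j = 0) :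
    ∃ i, ∀ j, x i j ^ 2 = 1 := by
  simp only [Fin.sum_univ_four, hx₀, div_one] at h h' hd
  have key := fun i i' hi => real_or_opposite_of_orthogonal (hx i 1) (hx i 2) (hx i 3) (hx i' 1)
    (hx i' 2) (hx i' 3) (h i) (h' i) (h i') (h' i') (hd i i' hi)
  have fin : ∀ i, x i 1 ^ 2 = 1 ∧ x i 2 ^ 2 = 1 ∧ x i 3 ^ 2 = 1 → ∃ i, ∀ j, x i j ^ 2 = 1 := by
    rintro i ⟨h1, h2, h3⟩
    refine ⟨i, fun j => ?_⟩
    fin_cases j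
    · simp [hx₀]
    · exact h1
    · exact h2
    · exact h3
  by_contra hne
  have hf : ∀ i, ¬(x i 1 ^ 2 = 1 ∧ x i 2 ^ 2 = 1 ∧ x i 3 ^ 2 = 1) := fun i hi => hne (fin i hi)
  have k01 := ((key 0 1 (by decide)).resolve_left (hf 0)).resolve_left (hf 1)
  have k02 := ((key 0 2 (by decide)).resolve_left (hf 0)).resolve_left (hf 2)
  -- If no row is real, row 0 has its `-1` in one and the same column in both comparisons, and it
  -- determines rows 1 and 2 alike; equal rows are not orthogonal.
  have heq : ∀ j, x 1 j = x 2 j := by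
    have hf0 := hf 0
    rcases k01 with ⟨a1, a2, a3, a4, a5⟩ | ⟨a1, a2, a3, a4, a5⟩ | ⟨a1, a2, a3, a4, a5⟩ <;>
    rcases k02 with ⟨b1, b2, b3, b4, b5⟩ | ⟨b1, b2, b3, b4, b5⟩ | ⟨b1, b2, b3, b4, b5⟩ <;>
    first
    | (refine absurd ?_ hf0; simp [a1, b1, a3, b3]; done)
    | (refine absurd ?_ hf0; rw [a1, neg_inj] at b3; simp [a1, b1, ← b3])
    | (intro j; fin_cases j <;> simp [hx₀, a2, a4, a5, b2, b4, b5])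
  have h12 := hd 1 2 (by decide)
  rw [heq 1, heq 2, heq 3, div_self (hx 2 1), div_self (hx 2 2), div_self (hx 2 3)] at h12
  norm_num at h12

theorem Circle.neg_one_ne_one : (-1 : Circle) ≠ 1 := by
  intro h
  have := congrArg (fun z : Circle => (z : ℂ)) h
  norm_num at this

/-- A complex Hadamard matrix of order four has a row whose ratio to the first one takes only two
opposite values. -/
theorem exists_row_eq_or_eq_neg {H : Fin 4 → Fin 4 → Circle}
    (hH : ∀ i i', i ≠ i' → ∑ j, ((H i j / H i' j : Circle) : ℂ) = 0) :
    ∃ i, i ≠ 0 ∧ ∀ j, H i j / H 0 j = H i 0 / H 0 0 ∨ H i j / H 0 j = -(H i 0 / H 0 0) := by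
  have hdiv : ∀ i i', i ≠ i' → ∀ z : Circle, ∑ j, ((H i j / H i' j / z : Circle) : ℂ) = 0 := by
    intro i i' hi z
    simp_rw [Circle.coe_div (_ / _)]
    rw [← Finset.sum_div, hH i i' hi, zero_div]
  obtain ⟨i, hi⟩ := exists_real_row (F := ℂ)
    (x := fun i j => ((H i.succ j / H 0 j / (H i.succ 0 / H 0 0) : Circle) : ℂ))
    (fun i => by simp) (fun i j => Circle.coe_ne_zero _)
    (fun i => hdiv _ _ (Fin.succ_ne_zero i) _)
    (fun i => by
      have := hdiv 0 i.succ (Fin.succ_ne_zero i).symm (H 0 0 / H i.succ 0)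
      refine (Finset.sum_congr rfl fun j _ => ?_).trans this
      rw [one_div, ← Circle.coe_inv, inv_div, div_div_div_eq, div_div_div_eq, mul_comm (H 0 j),
        mul_comm (H i.succ j)])
    (fun i i' hii => by
      have := hdiv i.succ i'.succ ((Fin.succ_injective _).ne hii) (H i.succ 0 / H i'.succ 0)
      refine (Finset.sum_congr rfl fun j _ => ?_).trans this
      rw [← Circle.coe_div, div_div_div_comm, div_div_div_cancel_right, div_div_div_cancel_right])
  refine ⟨i.succ, Fin.succ_ne_zero i, fun j => ?_⟩
  rcases (sq_eq_sq_iff_eq_or_eq_neg (b := (1 : ℂ))).mp ((hi j).trans (one_pow 2).symm) with h | h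
  · exact Or.inl (div_eq_one.mp (Circle.ext (by simpa using h)))
  · right
    rw [← neg_one_mul, ← div_eq_iff_eq_mul]
    exact Circle.ext (by simpa using h)

/-! ### From spectra to tilings, by cardinality -/

namespace SpectralTile

variable {G : Type*} [AddCommGroup G] {A : Finset G}

/-- The characters in a spectrum of a set of `n` points form a complex Hadamard matrix. -/
theorem IsSpectral.exists_rows (hA : IsSpectral A) {n : ℕ} (hn : A.card = n) :
    ∃ (χ : Fin n → AddChar G Circle) (p : Fin n ≃ A), ∀ i i', i ≠ i' →
      ∑ j, ((χ i (p j) / χ i' (p j) : Circle) : ℂ) = 0 := by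
  obtain ⟨Λ, hΛ⟩ := hA
  let b : Module.Basis Λ ℂ (EuclideanSpace ℂ A) := Module.Basis.mk hΛ.linearIndependent (by
    rw [← hΛ.span_eq_top, Set.image_eq_range])
  -- The spectrum and the standard basis are bases of one space, so the matrix is square.
  obtain ⟨σ⟩ : Nonempty (A ≃ Λ) := ⟨(EuclideanSpace.basisFun A ℂ).toBasis.indexEquiv b⟩
  obtain ⟨p⟩ : Nonempty (Fin n ≃ A) := ⟨(A.equivFinOfCardEq hn).symm⟩
  refine ⟨fun i => σ (p i), p, fun i i' hi => ?_⟩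
  have h := hΛ.orthogonal _ (σ (p i')).2 _ (σ (p i)).2 fun e =>
    hi (p.injective (σ.injective (Subtype.ext e))).symm
  rw [← h, PiLp.inner_apply, ← Equiv.sum_comp p]
  refine Finset.sum_congr rfl fun j _ => ?_
  simp [restrict, div_eq_mul_inv, ← Circle.coe_inv_eq_conj]

theorem tiles_of_card_one (hn : A.card = 1) : Tiles A := by
  obtain ⟨a, rfl⟩ := Finset.card_eq_one.mp hn
  refine tiles_of_map (Q := Circle) (f := fun _ => 1) (by simp) Set.univ fun x => ?_
  exact ⟨⟨a, by simp⟩, trivial, fun b _ => Subtype.ext (Finset.mem_singleton.mp b.2)⟩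

/-- The ratio of two characters, as a homomorphism to the circle. -/
theorem div_map_sub (χ ψ : AddChar G Circle) (x y : G) :
    χ (x - y) / ψ (x - y) = (χ x / ψ x) / (χ y / ψ y) := by
  rw [AddChar.map_sub_eq_div, AddChar.map_sub_eq_div, div_div_div_comm]

theorem tiles_of_card_two (hA : IsSpectral A) (hn : A.card = 2) : Tiles A := by
  obtain ⟨χ, p, h⟩ := hA.exists_rows hn
  have h10 := h 1 0 (by decide)
  set f : G → Circle := fun x => χ 1 x / χ 0 x
  change ∑ j, (f (p j) : ℂ) = 0 at h10
  rw [Fin.sum_univ_two] at h10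
  have e : f (p 1) = -f (p 0) := Circle.ext (by rw [Circle.coe_neg]; linear_combination h10)
  refine tiles_of_stable (f := f) Nat.prime_two p (div_map_sub (χ 1) (χ 0)) ?_
    Circle.neg_one_ne_one ?_
  · have h01 : f (p 0) ≠ f (p 1) := by
      rw [e, ← neg_one_mul, Ne, right_eq_mul]
      exact Circle.neg_one_ne_one
    intro i j hij
    fin_cases i <;> fin_cases j <;> first | rfl | exact absurd hij h01 | exact absurd hij h01.symm
  · simp only [neg_one_mul, Fin.exists_fin_two, Fin.forall_fin_two]
    exact ⟨Or.inr e, Or.inl (by rw [e, neg_neg])⟩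

theorem tiles_of_card_three (hA : IsSpectral A) (hn : A.card = 3) : Tiles A := by
  obtain ⟨χ, p, h⟩ := hA.exists_rows hn
  have h10 := h 1 0 (by decide)
  set f : G → Circle := fun x => χ 1 x / χ 0 x
  change ∑ j, (f (p j) : ℂ) = 0 at h10
  have h01 := Circle.sum_inv_eq_zero h10
  simp only [Fin.sum_univ_three, Circle.coe_inv] at h10 h01
  have n0 := Circle.coe_ne_zero (f (p 0))
  have n1 := Circle.coe_ne_zero (f (p 1))
  have n2 := Circle.coe_ne_zero (f (p 2))
  field_simp at h01
  -- The first two elementary symmetric functions of the three values vanish, so the values form a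
  -- cyclic geometric progression.
  have e0 : f (p 1) * f (p 2) = f (p 0) * f (p 0) :=
    Circle.ext (by simp only [Circle.coe_mul]; linear_combination h01 - f (p 0) * h10)
  have e1 : f (p 1) * f (p 1) = f (p 2) * f (p 0) :=
    Circle.ext (by simp only [Circle.coe_mul]; linear_combination f (p 1) * h10 - h01)
  have e2 : f (p 2) * f (p 2) = f (p 0) * f (p 1) :=
    Circle.ext (by simp only [Circle.coe_mul]; linear_combination f (p 2) * h10 - h01)
  have hne : f (p 1) ≠ f (p 0) := by
    intro e
    rw [e] at e1 h10
    rw [← mul_right_cancel e1] at h10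
    exact n0 (by linear_combination h10 / 3)
  refine tiles_of_stable (f := f) Nat.prime_three p (div_map_sub (χ 1) (χ 0)) ?_
    (div_ne_one.mpr hne) ?_
  · have hne1 : f (p 2) ≠ f (p 1) := by
      intro e
      rw [e] at e1
      exact hne (mul_left_cancel e1)
    have hne2 : f (p 0) ≠ f (p 2) := by
      intro e
      rw [← e] at e2
      exact hne (mul_left_cancel e2).symm
    intro i j hij
    fin_cases i <;> fin_cases j <;>
    first
    | rfl
    | exact absurd hij hne | exact absurd hij hne1 | exact absurd hij hne2
    | exact absurd hij.symm hne | exact absurd hij.symm hne1 | exact absurd hij.symm hne2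
  · intro j
    fin_cases j
    · exact ⟨1, by simp⟩
    · exact ⟨2, by simp [div_mul_eq_mul_div, e1]⟩
    · exact ⟨0, by simp [div_mul_eq_mul_div, e0]⟩

/-- Orthogonality of `g` to the rows `1` and `f` makes `g 0 + g 1 + g 2 + g 3` and `g 0 + g 1 - g 2
- g 3` vanish (indices for columns), so `g` is opposite within each pair. -/
theorem tiles_of_balanced_row {f g : G → Circle} (p : Fin 4 ≃ A)
    (hf : ∀ x y, f (x - y) = f x / f y) (hg : ∀ x y, g (x - y) = g x / g y)
    (hg₀ : ∑ j, (g (p j) : ℂ) = 0) (hgf : ∑ j, ((g (p j) / f (p j) : Circle) : ℂ) = 0)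
    (hf₁ : f (p 1) = f (p 0)) (hf₂ : f (p 2) = -f (p 0)) (hf₃ : f (p 3) = -f (p 0)) :
    Tiles A := by
  rw [Fin.sum_univ_four] at hg₀
  simp only [Fin.sum_univ_four, hf₁, hf₂, hf₃, Circle.coe_div, Circle.coe_neg] at hgf
  have hne := Circle.coe_ne_zero (f (p 0))
  field_simp at hgf
  apply tiles_of_two_pairs p hf hg hf₁ hf₂ hf₃ <;> refine Circle.ext ?_ <;> rw [Circle.coe_neg]
  · linear_combination (hg₀ + hgf) / 2
  · linear_combination (hg₀ - hgf) / 2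

/-- A vanishing sum of four signs has two of each; a permutation of the columns brings them into
standard order. -/
theorem tiles_of_real_row {f g : G → Circle} (p : Fin 4 ≃ A)
    (hf : ∀ x y, f (x - y) = f x / f y) (hg : ∀ x y, g (x - y) = g x / g y)
    (hf₀ : ∑ j, (f (p j) : ℂ) = 0) (hg₀ : ∑ j, (g (p j) : ℂ) = 0)
    (hgf : ∑ j, ((g (p j) / f (p j) : Circle) : ℂ) = 0)
    (hreal : ∀ j, f (p j) = f (p 0) ∨ f (p j) = -f (p 0)) : Tiles A := by
  have perm : ∀ e : Equiv.Perm (Fin 4), f (p (e 1)) = f (p (e 0)) →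
      f (p (e 2)) = -f (p (e 0)) → f (p (e 3)) = -f (p (e 0)) → Tiles A := fun e h₁ h₂ h₃ =>
    tiles_of_balanced_row (e.trans p) hf hg
      ((Equiv.sum_comp e fun j => (g (p j) : ℂ)).trans hg₀)
      ((Equiv.sum_comp e fun j => ((g (p j) / f (p j) : Circle) : ℂ)).trans hgf) h₁ h₂ h₃
  have hne := Circle.coe_ne_zero (f (p 0))
  rw [Fin.sum_univ_four] at hf₀
  rcases hreal 1 with h₁ | h₁ <;> rcases hreal 2 with h₂ | h₂ <;> rcases hreal 3 with h₃ | h₃ <;>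
  simp only [h₁, h₂, h₃, Circle.coe_neg] at hf₀
  · exact absurd (by linear_combination hf₀ / 4) hne
  · exact absurd (by linear_combination hf₀ / 2) hne
  · exact absurd (by linear_combination hf₀ / 2) hne
  · exact perm 1 h₁ h₂ h₃
  · exact absurd (by linear_combination hf₀ / 2) hne
  · exact perm (Equiv.swap 1 2) h₂ h₁ h₃
  · exact perm (Equiv.swap 1 3) h₃ h₂ h₁
  · exact absurd (by linear_combination -hf₀ / 2) hne

theorem tiles_of_card_four (hA : IsSpectral A) (hn : A.card = 4) : Tiles A := by
  obtain ⟨χ, p, h⟩ := hA.exists_rows hn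
  obtain ⟨i, hi, hf⟩ := exists_row_eq_or_eq_neg (H := fun i j => χ i (p j)) h
  obtain ⟨k, hk, hki⟩ : ∃ k, k ≠ 0 ∧ k ≠ i :=
    (by decide : ∀ i : Fin 4, ∃ k, k ≠ 0 ∧ k ≠ i) i
  refine tiles_of_real_row (f := fun x => χ i x / χ 0 x) (g := fun x => χ k x / χ 0 x) p
    (div_map_sub (χ i) (χ 0)) (div_map_sub (χ k) (χ 0)) (h i 0 hi)
    (h k 0 hk) ?_ hf
  simpa only [div_div_div_cancel_right] using h k i hki

theorem tiles_of_card_five (hA : IsSpectral A) (hn : A.card = 5) : Tiles A := by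
  obtain ⟨χ, p, h⟩ := hA.exists_rows hn
  have hT := isHaagerupTriple_of_rows (H := fun i j => χ i (p j)) h
  obtain ⟨c, hc, hS⟩ := hT.exists_stable
  exact tiles_of_stable (f := fun x => χ 1 x / χ 0 x) Nat.prime_five p (div_map_sub (χ 1) (χ 0))
    hT.fst_injective hc hS

end SpectralTile

theorem theorem2p3 (d : ℕ) (A : Finset (Fin d → ℤ)) (hA : A.Nonempty) (hcard : A.card ≤ 5)
    (hspec : SpectralTile.IsSpectral A) : SpectralTile.Tiles A := by
  have hpos := hA.card_pos
  obtain hn | hn | hn | hn | hn :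
      A.card = 1 ∨ A.card = 2 ∨ A.card = 3 ∨ A.card = 4 ∨ A.card = 5 := by omega
  · exact SpectralTile.tiles_of_card_one hn
  · exact SpectralTile.tiles_of_card_two hspec hn
  · exact SpectralTile.tiles_of_card_three hspec hn
  · exact SpectralTile.tiles_of_card_four hspec hn
  · exact SpectralTile.tiles_of_card_five hspec hn
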